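/- Let $H\in(0,\tfrac12)$, $x_0>0$, $\sigma>0$, and let $B^H=\{B^H_t,\,t\ge0\}$ be a fractional Brownian motion with Hurst index $H$ on a probability space $(\Omega,\mathcal F,\mathbb P)$, i.e. a centred Gaussian process with covariance $\mathbb E B^H_tB^H_s=\frac12\bigl(t^{2H}+s^{2H}-|t-s|^{2H}\bigr)$ and almost surely continuous paths. For $a>0$ and $\delta>0$ let $Y^{a,\delta}$ be the (pathwise unique, continuous) solution of $$Y^{a,\delta}_t=x_0+a\int_0^t\frac{ds}{Y^{a,\delta}_s\mathbf 1_{\{Y^{a,\delta}_s>0\}}+\delta}+\sigma B^H_t,\qquad t\ge0,$$ and let $X^{H,a}_t=\lim_{\delta\downarrow0}Y^{a,\delta}_t$, $t\ge0$, be the fractional diffusion Bessel process (the limit exists almost surely for all $t$ simultaneously). Then for every $\varepsilon>0$ there is $a_0>0$ such that for all $a\ge a_0$ $$\mathbb P\Bigl\{\inf_{t\ge0}X^{H,a}_t=0\Bigr\}<\varepsilon .$$ In other words, for large drift coefficient $a$ the process never hits zero with probability close to one: also $\mathbb P\{\exists\,t\ge0:\ X^{H,a}_t=0\}<\varepsilon$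 for all $a\ge a_0$. -/

import Mathlib

open MeasureTheory ProbabilityTheory Filter Set
open scoped NNReal ENNReal Topology

namespace FracBessel

/-- `B` is a fractional Brownian motion with Hurst index `H` under `P`: a Gaussian process, indexed
by `t ≥ 0`, with zero mean, covariance `(t ^ (2H) + s ^ (2H) - |t - s| ^ (2H)) / 2`, and almost
surely continuous sample paths. -/
structure IsFractionalBrownianMotion {Ω : Type*} [MeasurableSpace Ω] (H : ℝ)
    (B : ℝ≥0 → Ω → ℝ) (P : Measure Ω) : Prop where
  isGaussianProcess : IsGaussianProcess B P
  mean_eq_zero : ∀ t, ∫ ω, B t ω ∂P = 0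
  covariance_eq : ∀ s t : ℝ≥0, ∫ ω, B t ω * B s ω ∂P =
    ((t : ℝ) ^ (2 * H) + (s : ℝ) ^ (2 * H) - |(t : ℝ) - (s : ℝ)| ^ (2 * H)) / 2
  continuous_paths : ∀ᵐ ω ∂P, Continuous fun t ↦ B t ω

/-- The function `x ↦ 1 / (x 𝟙_{x > 0} + ε)`; note that `x 𝟙_{x > 0} = max x 0`. -/
noncomputable def regInv (ε x : ℝ) : ℝ := 1 / (max x 0 + ε)

/-- `y` is a (continuous) solution on `[0, ∞)` of the regularised equation
`y t = x₀ + a ∫₀ᵗ ds / (y s 𝟙_{y s > 0} + ε) + σ b t` driven by the path `b`. -/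
structure IsApproxSolution (x₀ a σ ε : ℝ) (b y : ℝ≥0 → ℝ) : Prop where
  continuous : Continuous y
  eq : ∀ t : ℝ≥0, y t =
    x₀ + a * (∫ s in (0 : ℝ)..(t : ℝ), regInv ε (y s.toNNReal)) + σ * b t

/-- The solution of the regularised equation driven by the path `b`. It exists and is unique when
`b` is continuous and `a, ε > 0`; see `existsUnique_isApproxSolution`. -/
noncomputable def approxPath (x₀ a σ ε : ℝ) (b : ℝ≥0 → ℝ) : ℝ≥0 → ℝ :=
  Classical.epsilon (IsApproxSolution x₀ a σ ε b)

/-- The path of the fractional diffusion Bessel process driven by `b`: the pointwise limit, as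
`ε ↓ 0`, of the solutions of the regularised equations. The limit exists when `b` is continuous
and `a > 0`; see `tendsto_approxPath`. -/
noncomputable def besselPath (x₀ a σ : ℝ) (b : ℝ≥0 → ℝ) (t : ℝ≥0) : ℝ :=
  limUnder (𝓝[>] (0 : ℝ)) fun ε ↦ approxPath x₀ a σ ε b t

/-- The fractional diffusion Bessel process `X^{H,a}` with initial value `x₀`, drift coefficient
`a`, and noise `σ B`, where `B` is a fractional Brownian motion with Hurst index `H`. -/
noncomputable def besselProcess {Ω : Type*} (x₀ a σ : ℝ) (B : ℝ≥0 → Ω → ℝ) (t : ℝ≥0) (ω : Ω) : ℝ :=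
  besselPath x₀ a σ (fun s ↦ B s ω) t

/-! ### The definitions are meaningful -/

lemma continuous_regInv {ε : ℝ} (hε : 0 < ε) : Continuous (regInv ε) := by
  unfold regInv
  refine continuous_const.div (by fun_prop) fun x ↦ ?_
  have := le_max_right x 0
  linarith

lemma regInv_nonneg {ε : ℝ} (hε : 0 < ε) (x : ℝ) : 0 ≤ regInv ε x := by
  unfold regInv
  positivity

lemma regInv_le {ε : ℝ} (hε : 0 < ε) (x : ℝ) : regInv ε x ≤ 1 / ε := by
  unfold regInv
  gcongr
  have := le_max_right x 0
  linarith

lemma regInv_anti {ε δ x y : ℝ} (hε : 0 < ε) (h : ε ≤ δ) (hxy : x ≤ y) :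
    regInv δ y ≤ regInv ε x := by
  unfold regInv
  have := le_max_right x 0
  gcongr

lemma lipschitz_regInv {ε : ℝ} (hε : 0 < ε) :
    LipschitzWith (Real.toNNReal (1 / ε ^ 2)) (regInv ε) := by
  refine LipschitzWith.of_dist_le_mul fun x y ↦ ?_
  rw [Real.coe_toNNReal _ (by positivity), Real.dist_eq, Real.dist_eq]
  have hx := le_max_right x 0
  have hy := le_max_right y 0
  have h : regInv ε x - regInv ε y = (max y 0 - max x 0) / ((max x 0 + ε) * (max y 0 + ε)) := by
    unfold regInv
    rw [div_sub_div _ _ (by linarith) (by linarith)]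
    ring
  have h1 : |max y 0 - max x 0| ≤ |x - y| := by
    rw [abs_sub_comm x y]
    exact abs_max_sub_max_le_abs y x 0
  have h2 : ε ^ 2 ≤ (max x 0 + ε) * (max y 0 + ε) := by nlinarith
  rw [h, abs_div, abs_of_pos (show 0 < (max x 0 + ε) * (max y 0 + ε) by nlinarith),
    div_eq_inv_mul, one_div]
  gcongr

/-- The drift part of a solution is differentiable. -/
lemma IsApproxSolution.hasDerivAt {x₀ a σ ε : ℝ} {b y : ℝ≥0 → ℝ}
    (h : IsApproxSolution x₀ a σ ε b y) (hε : 0 < ε) (t : ℝ) :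
    HasDerivAt (fun u : ℝ ↦ x₀ + a * ∫ s in (0 : ℝ)..u, regInv ε (y s.toNNReal))
      (a * regInv ε (y t.toNNReal)) t := by
  have hc : Continuous fun s : ℝ ↦ regInv ε (y s.toNNReal) :=
    (continuous_regInv hε).comp (h.continuous.comp continuous_real_toNNReal)
  exact ((hc.integral_hasStrictDerivAt 0 t).hasDerivAt.const_mul a).const_add x₀

/-- Comparison: solutions increase when the regularisation parameter decreases. -/
lemma IsApproxSolution.le {x₀ a σ ε δ : ℝ} {b y z : ℝ≥0 → ℝ} (ha : 0 ≤ a) (hε : 0 < ε)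
    (hεδ : ε ≤ δ) (hy : IsApproxSolution x₀ a σ ε b y) (hz : IsApproxSolution x₀ a σ δ b z)
    (t : ℝ≥0) : z t ≤ y t := by
  have key : ∀ η : ℝ, 0 < η → z t - y t ≤ η * (1 + t) := by
    intro η hη
    have hd : ∀ u : ℝ, HasDerivAt (fun u : ℝ ↦
        (x₀ + a * ∫ s in (0 : ℝ)..u, regInv δ (z s.toNNReal)) -
          (x₀ + a * ∫ s in (0 : ℝ)..u, regInv ε (y s.toNNReal)))
        (a * regInv δ (z u.toNNReal) - a * regInv ε (y u.toNNReal)) u := fun u ↦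
      (hz.hasDerivAt (hε.trans_le hεδ) u).sub (hy.hasDerivAt hε u)
    have hB : ∀ u : ℝ, HasDerivAt (fun u : ℝ ↦ η * (1 + u)) η u := fun u ↦ by
      simpa using ((hasDerivAt_id u).const_add 1).const_mul η
    have := image_le_of_deriv_right_lt_deriv_boundary (a := 0) (b := (t : ℝ))
      (fun u _ ↦ (hd u).continuousAt.continuousWithinAt)
      (fun u _ ↦ (hd u).hasDerivWithinAt) (by simpa using hη.le) hB
      (fun u hu hu' ↦ by
        have h1 := hz.eq u.toNNReal
        have h2 := hy.eq u.toNNReal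
        rw [Real.coe_toNNReal u hu.1] at h1 h2
        have h3 : 0 < η * (1 + u) := mul_pos hη (by linarith [hu.1])
        have h4 : regInv δ (z u.toNNReal) ≤ regInv ε (y u.toNNReal) :=
          regInv_anti hε hεδ (by linarith)
        nlinarith) (right_mem_Icc.2 t.2)
    have h1 := hz.eq t
    have h2 := hy.eq t
    linarith
  have ht : (0 : ℝ) < 1 + t := by positivity
  refine le_of_forall_pos_le_add fun η hη ↦ ?_
  have := key (η / (1 + t)) (by positivity)
  rw [div_mul_cancel₀ _ ht.ne'] at this
  linarith

/-- Solutions are bounded above uniformly in the regularisation parameter. -/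
lemma exists_upper_bound {x₀ a σ : ℝ} {b : ℝ≥0 → ℝ} (ha : 0 < a) (hb : Continuous b) (t : ℝ≥0) :
    ∃ C, ∀ ε > 0, ∀ y, IsApproxSolution x₀ a σ ε b y → y t ≤ C := by
  obtain ⟨M, hM⟩ := (isCompact_Icc (a := (0 : ℝ≥0)) (b := t)).exists_bound_of_continuousOn
    (f := fun s ↦ σ * b s) (by fun_prop)
  refine ⟨|x₀| + 1 + M + a * t + M, fun ε hε y hy ↦ ?_⟩
  have hM0 : 0 ≤ M := (norm_nonneg _).trans (hM 0 (by simp))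
  have hB : ∀ u : ℝ, HasDerivAt (fun u : ℝ ↦ |x₀| + 1 + M + a * u) a u := fun u ↦ by
    simpa using ((hasDerivAt_id u).const_mul a).const_add (|x₀| + 1 + M)
  have := image_le_of_deriv_right_lt_deriv_boundary (a := 0) (b := (t : ℝ))
    (fun u _ ↦ (hy.hasDerivAt hε u).continuousAt.continuousWithinAt)
    (fun u _ ↦ (hy.hasDerivAt hε u).hasDerivWithinAt)
    (by simpa using by linarith [le_abs_self x₀]) hB
    (fun u hu hu' ↦ by
      have h1 := hy.eq u.toNNReal
      rw [Real.coe_toNNReal u hu.1] at h1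
      have h2 := hM u.toNNReal ⟨zero_le, Real.toNNReal_le_iff_le_coe.2 hu.2.le⟩
      rw [Real.norm_eq_abs] at h2
      have h3 := neg_le_of_abs_le h2
      have h4 : 1 ≤ y u.toNNReal := by
        have := abs_nonneg x₀
        have := mul_nonneg ha.le hu.1
        linarith
      have h5 : regInv ε (y u.toNNReal) < 1 := by
        unfold regInv
        rw [div_lt_one (by positivity)]
        have := le_max_left (y u.toNNReal) 0
        linarith
      nlinarith) (right_mem_Icc.2 t.2)
  have h1 := hy.eq t
  have h2 := hM t ⟨zero_le, le_rfl⟩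
  rw [Real.norm_eq_abs] at h2
  have h3 := le_of_abs_le h2
  linarith

/-- Existence and uniqueness for the regularised equation. -/
theorem existsUnique_isApproxSolution (x₀ σ : ℝ) {a ε : ℝ} {b : ℝ≥0 → ℝ} (ha : 0 ≤ a)
    (hε : 0 < ε) (hb : Continuous b) : ∃! y, IsApproxSolution x₀ a σ ε b y := by
  -- the equation for the drift part on `[0, T]`
  have loc : ∀ T : ℝ≥0, ∃ z : ℝ → ℝ, z 0 = x₀ ∧ ∀ t ∈ Icc (0 : ℝ) T,
      HasDerivWithinAt z (a * regInv ε (z t + σ * b t.toNNReal)) (Icc 0 T) t := by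
    intro T
    have hP : IsPicardLindelof (fun t x ↦ a * regInv ε (x + σ * b t.toNNReal))
        (⟨0, by simp⟩ : Icc (0 : ℝ) T) x₀
        (Real.toNNReal (a * (1 / ε)) * T) 0 (Real.toNNReal (a * (1 / ε)))
        (Real.toNNReal a * Real.toNNReal (1 / ε ^ 2)) := by
      refine ⟨fun t _ ↦ ?_, fun x _ ↦ ?_, fun t _ x _ ↦ ?_, by simp⟩
      · refine LipschitzWith.lipschitzOnWith (LipschitzWith.of_dist_le_mul fun x y ↦ ?_)
        have := (lipschitz_regInv hε).dist_le_mul (x + σ * b t.toNNReal) (y + σ * b t.toNNReal)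
        rw [dist_add_right] at this
        rw [Real.dist_eq, ← mul_sub, abs_mul, abs_of_nonneg ha, ← Real.dist_eq, NNReal.coe_mul,
          Real.coe_toNNReal _ ha, mul_assoc]
        gcongr
      · have := continuous_regInv hε
        have := continuous_real_toNNReal
        fun_prop
      · rw [Real.norm_eq_abs, abs_of_nonneg (mul_nonneg ha (regInv_nonneg hε _)),
          Real.coe_toNNReal _ (by positivity)]
        gcongr
        exact regInv_le hε _
    exact hP.exists_eq_forall_mem_Icc_hasDerivWithinAt₀
  choose z hz0 hz using loc
  have hzc : ∀ T : ℝ≥0, ContinuousOn (z T) (Icc 0 T) := fun T t ht ↦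
    (hz T t ht).continuousWithinAt
  have huniq : ∀ T T' : ℝ≥0, T ≤ T' → EqOn (z T') (z T) (Icc 0 T) := by
    intro T T' hT
    have hT' : (T : ℝ) ≤ T' := by exact_mod_cast hT
    refine ODE_solution_unique_of_mem_Icc_right
      (v := fun t x ↦ a * regInv ε (x + σ * b t.toNNReal)) (s := fun _ ↦ univ)
      (K := Real.toNNReal a * Real.toNNReal (1 / ε ^ 2)) (fun t _ ↦ ?_)
      ((hzc T').mono (Icc_subset_Icc_right hT')) (fun t ht ↦ ?_) (fun _ _ ↦ mem_univ _)
      (hzc T) (fun t ht ↦ ?_) (fun _ _ ↦ mem_univ _) (by rw [hz0, hz0])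
    · refine LipschitzWith.lipschitzOnWith (LipschitzWith.of_dist_le_mul fun x y ↦ ?_)
      have := (lipschitz_regInv hε).dist_le_mul (x + σ * b t.toNNReal) (y + σ * b t.toNNReal)
      rw [dist_add_right] at this
      rw [Real.dist_eq, ← mul_sub, abs_mul, abs_of_nonneg ha, ← Real.dist_eq, NNReal.coe_mul,
        Real.coe_toNNReal _ ha, mul_assoc]
      gcongr
    · exact (hz T' t ⟨ht.1, ht.2.le.trans hT'⟩).mono_of_mem_nhdsWithin
        (Icc_mem_nhdsGE_of_mem ⟨ht.1, ht.2.trans_le hT'⟩)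
    · exact (hz T t ⟨ht.1, ht.2.le⟩).mono_of_mem_nhdsWithin (Icc_mem_nhdsGE_of_mem ⟨ht.1, ht.2⟩)
  set Z : ℝ≥0 → ℝ := fun t ↦ z t t with hZ
  have hZz : ∀ T t : ℝ≥0, t ≤ T → Z t = z T t := fun T t h ↦
    (huniq t T h ⟨t.2, le_rfl⟩).symm
  have hint : ∀ T : ℝ≥0, Z T =
      x₀ + a * ∫ s in (0 : ℝ)..T, regInv ε (Z s.toNNReal + σ * b s.toNNReal) := by
    intro T
    have hcont : ContinuousOn (fun s ↦ a * regInv ε (z T s + σ * b s.toNNReal)) (Icc 0 T) := by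
      have h1 := continuous_regInv hε
      have h2 : Continuous fun s : ℝ ↦ σ * b s.toNNReal :=
        continuous_const.mul (hb.comp continuous_real_toNNReal)
      exact continuousOn_const.mul (h1.comp_continuousOn ((hzc T).add h2.continuousOn))
    have h := intervalIntegral.integral_eq_sub_of_hasDeriv_right_of_le T.2 (hzc T)
      (fun t ht ↦ (hz T t ⟨ht.1.le, ht.2.le⟩).mono_of_mem_nhdsWithin
        (mem_nhdsWithin_of_mem_nhds (Icc_mem_nhds ht.1 ht.2)))
      (hcont.intervalIntegrable_of_Icc T.2)
    rw [hz0] at h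
    rw [← intervalIntegral.integral_const_mul]
    have h2 : (∫ s in (0 : ℝ)..T, a * regInv ε (Z s.toNNReal + σ * b s.toNNReal)) =
        ∫ s in (0 : ℝ)..T, a * regInv ε (z T s + σ * b s.toNNReal) := by
      refine intervalIntegral.integral_congr fun s hs ↦ ?_
      rw [uIcc_of_le T.coe_nonneg] at hs
      rw [hZz T s.toNNReal (Real.toNNReal_le_iff_le_coe.2 hs.2), Real.coe_toNNReal s hs.1]
    rw [h2]
    have h3 := hZz T T le_rfl
    simp only [NNReal.val_eq_coe] at h
    linarith
  have hZc : Continuous Z := by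
    rw [continuous_iff_continuousAt]
    intro t
    have h1 : ContinuousAt (fun s : ℝ≥0 ↦ z (t + 1) s) t := by
      have h2 : ContinuousWithinAt (z (t + 1)) (Icc 0 ((t + 1 : ℝ≥0) : ℝ)) t :=
        hzc (t + 1) t ⟨t.2, by simp⟩
      refine h2.tendsto.comp (tendsto_nhdsWithin_iff.2 ⟨NNReal.continuous_coe.tendsto t, ?_⟩)
      filter_upwards [Iic_mem_nhds (show t < t + 1 by simp)] with s hs
      exact ⟨s.2, by exact_mod_cast hs⟩
    refine h1.congr ?_
    filter_upwards [Iic_mem_nhds (show t < t + 1 by simp)] with s hs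
    exact (hZz _ _ hs).symm
  refine ⟨fun t ↦ Z t + σ * b t, ⟨by fun_prop, fun t ↦ ?_⟩, fun y hy ↦ ?_⟩
  · rw [hint t]
  · have hsol : IsApproxSolution x₀ a σ ε b (fun t ↦ Z t + σ * b t) :=
      ⟨by fun_prop, fun t ↦ by rw [hint t]⟩
    funext t
    exact le_antisymm (hsol.le ha hε le_rfl hy t) (hy.le ha hε le_rfl hsol t)

theorem isApproxSolution_approxPath (x₀ σ : ℝ) {a ε : ℝ} {b : ℝ≥0 → ℝ} (ha : 0 ≤ a)
    (hε : 0 < ε) (hb : Continuous b) :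
    IsApproxSolution x₀ a σ ε b (approxPath x₀ a σ ε b) :=
  Classical.epsilon_spec (existsUnique_isApproxSolution x₀ σ ha hε hb).exists

/-- The limit that defines `besselPath` exists. -/
theorem tendsto_approxPath (x₀ σ : ℝ) {a : ℝ} {b : ℝ≥0 → ℝ} (ha : 0 < a) (hb : Continuous b)
    (t : ℝ≥0) :
    Tendsto (fun ε ↦ approxPath x₀ a σ ε b t) (𝓝[>] (0 : ℝ)) (𝓝 (besselPath x₀ a σ b t)) := by
  refine tendsto_nhds_limUnder ?_
  obtain ⟨C, hC⟩ := exists_upper_bound (x₀ := x₀) (σ := σ) ha hb t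
  refine ⟨_, AntitoneOn.tendsto_nhdsGT (x := (0 : ℝ)) ?_ ⟨C, ?_⟩⟩
  · intro ε hε δ hδ h
    exact (isApproxSolution_approxPath x₀ σ ha.le hε hb).le ha.le hε h
      (isApproxSolution_approxPath x₀ σ ha.le hδ hb) t
  · rintro _ ⟨ε, hε, rfl⟩
    exact hC ε hε _ (isApproxSolution_approxPath x₀ σ ha.le hε hb)

end FracBessel

/-! The drift a/x alone moves the process on the scale √t, whereas for H < 1/2 the noise is almost
surely o(√t). Hence almost every path `b` of the noise satisfies `HasDiffusiveModulus η C b` for any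
prescribed η > 0 and some random C: an arbitrarily small multiple of √(1+T), plus a term of the same
shape as the drift accumulated at height √(1+T).

Deterministic half (`IsApproxSolution.mul_sqrt_le`): to fall from 2ρ√(1+s) below ρ√(1+t), a solution
must stay below 2ρ√(1+t) in between. There the drift is at least of order (a/ρ)(t-s)/√(1+t), which
for large a beats the C-term of the noise; the η-term is too small to cover the remaining drop. The
bound is uniform in the regularisation, so it passes to the limit and keeps the path above ρ.

Probabilistic half (`ae_eventually_abs_le_mul_sqrt`): Gaussian moments and dyadic chaining on [0,
4^m] give the o(√t) growth. As C is almost surely finite, one deterministic C serves outside an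
event of probability below ε. That event does not involve a, so a₀ can be chosen after it. -/

namespace FracBessel

/-! ### Deterministic barrier for the regularised solutions -/

/-- The increments of `b` are small on the diffusive scale: up to the time `T = max s t`, they are
at most `η √(1 + T) + C |t - s| / √(1 + T)`. -/
def HasDiffusiveModulus (η C : ℝ) (b : ℝ≥0 → ℝ) : Prop :=
  ∀ s t : ℝ≥0, |b t - b s| ≤ η * √(1 + ((max s t : ℝ≥0) : ℝ)) +
    C * |(t : ℝ) - s| / √(1 + ((max s t : ℝ≥0) : ℝ))

lemma HasDiffusiveModulus.mono {η C C' : ℝ} {b : ℝ≥0 → ℝ} (h : HasDiffusiveModulus η C b)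
    (hC : C ≤ C') : HasDiffusiveModulus η C' b := fun s t ↦ (h s t).trans (by gcongr)

/-- The increment of a solution dominates the drift computed at an upper bound of the solution. -/
lemma IsApproxSolution.increment_ge {x₀ a σ ε R : ℝ} {b y : ℝ≥0 → ℝ}
    (h : IsApproxSolution x₀ a σ ε b y) (ha : 0 ≤ a) (hε : 0 < ε) (hR : 0 ≤ R) {s t : ℝ≥0}
    (hst : s ≤ t) (hy : ∀ u, s < u → u ≤ t → y u ≤ R) :
    a * ((t - s) / (R + ε)) + σ * (b t - b s) ≤ y t - y s := by
  have hc : Continuous fun u : ℝ ↦ regInv ε (y u.toNNReal) :=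
    (continuous_regInv hε).comp (h.continuous.comp continuous_real_toNNReal)
  have hst' : (s : ℝ) ≤ t := by exact_mod_cast hst
  have h1 : (t - s) / (R + ε) ≤ ∫ u in (s : ℝ)..t, regInv ε (y u.toNNReal) := by
    have : ∫ _ in (s : ℝ)..t, 1 / (R + ε) = (t - s) / (R + ε) := by
      rw [intervalIntegral.integral_const, smul_eq_mul, mul_one_div]
    rw [← this]
    refine intervalIntegral.integral_mono_on_of_le_Ioo hst' (by simp)
      (hc.intervalIntegrable _ _) fun u hu ↦ ?_
    have := hy u.toNNReal ((Real.lt_toNNReal_iff_coe_lt).2 hu.1)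
      (Real.toNNReal_le_iff_le_coe.2 hu.2.le)
    unfold regInv
    have := le_max_right (y u.toNNReal) 0
    gcongr
    exact max_le ‹_› hR
  have h2 := intervalIntegral.integral_add_adjacent_intervals
    (hc.intervalIntegrable (μ := volume) 0 s) (hc.intervalIntegrable s t)
  rw [h.eq t, h.eq s, ← h2]
  have := mul_le_mul_of_nonneg_left h1 ha
  linarith

/-- If the driving path has small increments on the diffusive scale and the drift coefficient is
large, then solutions of the regularised equation stay above a multiple of `√(1 + t)`. -/
lemma IsApproxSolution.mul_sqrt_le {x₀ a σ ε ρ η C : ℝ} {b y : ℝ≥0 → ℝ}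
    (h : IsApproxSolution x₀ a σ ε b y) (hε : 0 < ε) (hερ : ε ≤ ρ) (hσ : 0 < σ)
    (hb : HasDiffusiveModulus η C b) (hb0 : b 0 = 0) (hx₀ : 2 * ρ ≤ x₀) (hη : σ * η ≤ ρ / 2)
    (hC : 0 ≤ C) (ha : 3 * ρ * (σ * C + 2 * ρ) ≤ a) (t : ℝ≥0) : ρ * √(1 + t) ≤ y t := by
  by_contra! hlt
  have hρ : 0 < ρ := hε.trans_le hερ
  have ha0 : 0 ≤ a := le_trans (by positivity) ha
  -- The last time `s` before `t` at or above the barrier 2ρ√(1+u) starts the excursion; time 0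
  -- qualifies because 2ρ ≤ x₀.
  set S : Set ℝ≥0 := {u | u ≤ t ∧ 2 * ρ * √(1 + u) ≤ y u} with hS
  have hSc : IsClosed S := by
    refine isClosed_Iic.inter (isClosed_le ?_ h.continuous)
    fun_prop
  have hS0 : (0 : ℝ≥0) ∈ S := ⟨zero_le, by
    have := h.eq 0
    simp [hb0] at this
    simp [this, hx₀]⟩
  have hSb : BddAbove S := ⟨t, fun u hu ↦ hu.1⟩
  set s := sSup S
  have hs : s ∈ S := hSc.csSup_mem ⟨0, hS0⟩ hSb
  have hst : (s : ℝ) ≤ t := by exact_mod_cast hs.1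
  obtain ⟨p, hp⟩ : ∃ p, p = √(1 + (s : ℝ)) := ⟨_, rfl⟩
  obtain ⟨q, hq⟩ : ∃ q, q = √(1 + (t : ℝ)) := ⟨_, rfl⟩
  have hp2 : p ^ 2 = 1 + s := by rw [hp, Real.sq_sqrt (by positivity)]
  have hq2 : q ^ 2 = 1 + t := by rw [hq, Real.sq_sqrt (by positivity)]
  have hp0 : 0 < p := by rw [hp]; positivity
  have hq1 : 1 ≤ q := by rw [hq, Real.one_le_sqrt]; simp
  have hpq : p ≤ q := by rw [hp, hq]; gcongr
  have hinc := h.increment_ge ha0 hε (R := 2 * ρ * q) (by positivity) hs.1 fun u hsu hut ↦ by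
    have : u ∉ S := fun hu ↦ hsu.not_ge (le_csSup hSb hu)
    have h1 : y u < 2 * ρ * √(1 + u) := by
      by_contra! h2
      exact this ⟨hut, h2⟩
    refine h1.le.trans ?_
    rw [hq]
    gcongr
  have hmod := hb s t
  rw [max_eq_right hs.1, ← hq, abs_of_nonneg (sub_nonneg.2 hst)] at hmod
  have hmod' := mul_le_mul_of_nonneg_left ((neg_le_abs _).trans hmod) hσ.le
  have hts : (t : ℝ) - s = q ^ 2 - p ^ 2 := by rw [hp2, hq2]; ring
  have hu0 : 0 ≤ q ^ 2 - p ^ 2 := by rw [← hts]; linarith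
  -- Since ε ≤ ρ and q ≥ 1, the denominator is at most 3ρq. This is the source of the factor 3ρ in
  -- the bound on `a`: σC cancels the noise and 2ρ is left over.
  have hdrift : (σ * C + 2 * ρ) * ((q ^ 2 - p ^ 2) / q) ≤
      a * ((q ^ 2 - p ^ 2) / (2 * ρ * q + ε)) := by
    have h1 : (q ^ 2 - p ^ 2) / (3 * ρ * q) ≤ (q ^ 2 - p ^ 2) / (2 * ρ * q + ε) := by
      gcongr
      nlinarith
    calc (σ * C + 2 * ρ) * ((q ^ 2 - p ^ 2) / q)
        = 3 * ρ * (σ * C + 2 * ρ) * ((q ^ 2 - p ^ 2) / (3 * ρ * q)) := by field_simp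
      _ ≤ _ := by gcongr
  rw [hts] at hinc hmod'
  have hys := hs.2
  rw [← hp] at hys
  rw [← hq] at hlt
  have h3 : 2 * ρ * ((q ^ 2 - p ^ 2) / q) < 3 / 2 * ρ * q - 2 * ρ * p := by
    have h4 : σ * (C * (q ^ 2 - p ^ 2) / q) = σ * C * ((q ^ 2 - p ^ 2) / q) := by ring
    have h5 : σ * η * q ≤ ρ / 2 * q := by gcongr
    nlinarith
  rw [mul_div_assoc', div_lt_iff₀ (by positivity)] at h3
  have h6 : ρ * (2 * (q ^ 2 - p ^ 2) + 2 * p * q - 3 / 2 * q ^ 2) < 0 := by linarith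
  -- The expression equals 2p(q - p) + q²/2, and p ≤ q.
  have h7 : 0 ≤ 2 * (q ^ 2 - p ^ 2) + 2 * p * q - 3 / 2 * q ^ 2 := by nlinarith
  have := mul_nonneg hρ.le h7
  linarith

/-- For a large drift coefficient, the Bessel path stays away from zero. -/
lemma le_besselPath {x₀ a σ ρ η C : ℝ} {b : ℝ≥0 → ℝ} (hρ : 0 < ρ) (hσ : 0 < σ)
    (hbc : Continuous b) (hb : HasDiffusiveModulus η C b) (hb0 : b 0 = 0) (hx₀ : 2 * ρ ≤ x₀)
    (hη : σ * η ≤ ρ / 2) (hC : 0 ≤ C) (ha : 3 * ρ * (σ * C + 2 * ρ) ≤ a) (t : ℝ≥0) :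
    ρ ≤ besselPath x₀ a σ b t := by
  have ha0 : 0 < a := lt_of_lt_of_le (by positivity) ha
  refine ge_of_tendsto (tendsto_approxPath x₀ σ ha0 hbc t) ?_
  filter_upwards [Ioc_mem_nhdsGT hρ] with ε hε
  have h1 := (isApproxSolution_approxPath x₀ σ ha0.le hε.1 hbc).mul_sqrt_le hε.1 hε.2 hσ hb hb0
    hx₀ hη hC ha t
  have h2 : 1 ≤ √(1 + (t : ℝ)) := by rw [Real.one_le_sqrt]; simp
  nlinarith

/-! ### From growth o(√t) to the diffusive modulus -/

/-- A continuous path which is `o(√t)` has small increments on the diffusive scale. -/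
lemma exists_hasDiffusiveModulus {η : ℝ} (hη : 0 < η) {b : ℝ≥0 → ℝ} (hb : Continuous b)
    (hlim : ∀ δ > 0, ∀ᶠ t : ℝ≥0 in atTop, |b t| ≤ δ * √(1 + t)) :
    ∃ n : ℕ, HasDiffusiveModulus η n b := by
  obtain ⟨T₀, hT₀⟩ := eventually_atTop.1 (hlim (η / 2) (by positivity))
  obtain ⟨M, hM⟩ := (isCompact_Icc (a := (0 : ℝ≥0)) (b := T₀)).exists_bound_of_continuousOn
    (f := b) hb.continuousOn
  have hsq : Tendsto (fun t : ℝ≥0 ↦ η / 2 * √(1 + t)) atTop atTop :=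
    (Real.tendsto_sqrt_atTop.comp (tendsto_atTop_add_const_left _ _
      (NNReal.tendsto_coe_atTop.2 tendsto_id))).const_mul_atTop (by positivity)
  -- Past `T₁` the bound also covers the values of `b` on [0, T₀], so for a late `t` it holds at
  -- every earlier `s`.
  obtain ⟨T₁, hT₁⟩ := eventually_atTop.1 (hsq.eventually_ge_atTop M)
  set T := max T₀ T₁
  have hbT : ∀ s t : ℝ≥0, s ≤ t → T ≤ t → |b s| ≤ η / 2 * √(1 + t) := by
    intro s t hst ht
    rcases le_total T₀ s with hs | hs
    · refine (hT₀ s hs).trans ?_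
      gcongr
    · exact (hM s ⟨zero_le, hs⟩).trans (hT₁ t ((le_max_right _ _).trans ht))
  obtain ⟨M', hM'⟩ := (isCompact_Icc (a := (0 : ℝ≥0)) (b := T)).exists_bound_of_continuousOn
    (f := b) hb.continuousOn
  have huc := (isCompact_Icc (a := (0 : ℝ≥0)) (b := T)).uniformContinuousOn_of_continuous
    hb.continuousOn
  obtain ⟨d, hd, hbd⟩ := Metric.uniformContinuousOn_iff.1 huc η hη
  have hM0 : 0 ≤ M' := (norm_nonneg _).trans (hM' 0 (by simp))
  -- Before `T`, increments over less than `d` are below η by uniform continuity; for gaps of at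
  -- least `d`, this `n` makes the second term exceed the trivial bound 2M'.
  obtain ⟨n, hn⟩ := exists_nat_ge (2 * M' / d * √(1 + T))
  refine ⟨n, fun s t ↦ ?_⟩
  have hrem : 0 ≤ n * |(t : ℝ) - s| / √(1 + ((max s t : ℝ≥0) : ℝ)) := by positivity
  rcases le_total T (max s t) with h | h
  · have h1 := hbT s _ (le_max_left s t) h
    have h2 := hbT t _ (le_max_right s t) h
    have := abs_sub (b t) (b s)
    linarith
  · have hs : s ∈ Icc 0 T := ⟨zero_le, (le_max_left _ _).trans h⟩
    have ht : t ∈ Icc 0 T := ⟨zero_le, (le_max_right _ _).trans h⟩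
    have h1 : 1 ≤ √(1 + ((max s t : ℝ≥0) : ℝ)) := by
      rw [Real.one_le_sqrt]
      linarith [(max s t).coe_nonneg]
    rcases lt_or_ge (dist t s) d with hts | hts
    · have := hbd t ht s hs hts
      rw [Real.dist_eq] at this
      nlinarith
    · rw [NNReal.dist_eq] at hts
      have h2 := hM' s hs
      have h3 := hM' t ht
      rw [Real.norm_eq_abs] at h2 h3
      have h4 := abs_sub (b t) (b s)
      have h5 : 2 * M' ≤ n * |(t : ℝ) - s| / √(1 + ((max s t : ℝ≥0) : ℝ)) := by
        rw [le_div_iff₀ (by positivity)]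
        calc 2 * M' * √(1 + ((max s t : ℝ≥0) : ℝ)) ≤ 2 * M' * √(1 + T) := by gcongr
          _ = 2 * M' / d * √(1 + T) * d := by field_simp
          _ ≤ n * |(t : ℝ) - s| := by gcongr
      have h6 : 0 ≤ η * √(1 + ((max s t : ℝ≥0) : ℝ)) := by positivity
      linarith

/-! ### Dyadic chaining -/

/-- Chaining at dyadic points: if the increments over the dyadic intervals of generation `n` are at
most `d n`, then the oscillation from the origin at dyadic points is at most `∑ d n`. -/
lemma abs_sub_le_sum_of_dyadic {f : ℝ≥0 → ℝ} {L : ℝ≥0} {d : ℕ → ℝ}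
    (h : ∀ n : ℕ, ∀ k < 2 ^ n, |f (L * (k + 1 : ℕ) / 2 ^ n) - f (L * k / 2 ^ n)| ≤ d n)
    (n : ℕ) : ∀ k : ℕ, k ≤ 2 ^ n → |f (L * k / 2 ^ n) - f 0| ≤ ∑ i ∈ Finset.range (n + 1), d i := by
  induction n with
  | zero =>
    have h0 := h 0 0 (by simp)
    have hd := (abs_nonneg _).trans h0
    intro k hk
    interval_cases k
    · simpa using hd
    · simpa using h0
  | succ n ih =>
    have hd : 0 ≤ d (n + 1) := (abs_nonneg _).trans (h (n + 1) 0 (by positivity))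
    have key : ∀ j : ℕ, L * (2 * j : ℕ) / 2 ^ (n + 1) = L * j / 2 ^ n := fun j ↦ by
      push_cast
      rw [pow_succ]
      field_simp
    intro k hk
    rw [Finset.sum_range_succ]
    rw [pow_succ] at hk
    -- An even point belongs to the previous generation; an odd one is a single step of the new
    -- generation away from it.
    obtain ⟨j, rfl | rfl⟩ := Nat.even_or_odd' k
    · have := ih j (by omega)
      rw [key]
      linarith
    · have h1 := ih j (by omega)
      have h2 := h (n + 1) (2 * j) (by rw [pow_succ]; omega)
      rw [key] at h2
      have := abs_sub_le (f (L * (2 * j + 1 : ℕ) / 2 ^ (n + 1))) (f (L * j / 2 ^ n)) (f 0)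
      linarith

/-- Chaining on an interval, for a continuous function with geometrically decreasing dyadic
increments. -/
lemma abs_sub_le_of_dyadic {f : ℝ≥0 → ℝ} (hf : Continuous f) {L : ℝ≥0} {D r : ℝ} (hr : 0 ≤ r)
    (hr1 : r < 1)
    (h : ∀ n : ℕ, ∀ k < 2 ^ n, |f (L * (k + 1 : ℕ) / 2 ^ n) - f (L * k / 2 ^ n)| ≤ D * r ^ n)
    {t : ℝ≥0} (ht : t ≤ L) : |f t - f 0| ≤ D / (1 - r) := by
  rcases eq_zero_or_pos L with rfl | hL
  · have := (abs_nonneg _).trans (h 0 0 (by simp))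
    obtain rfl : t = 0 := le_antisymm ht zero_le
    have : 0 ≤ D := by simpa using this
    have : 0 < 1 - r := by linarith
    simp
    positivity
  have hD : 0 ≤ D := by simpa using (abs_nonneg _).trans (h 0 0 (by simp))
  have hlim : Tendsto (fun n : ℕ ↦ L * (⌊t / L * 2 ^ n⌋₊ : ℕ) / 2 ^ n) atTop (𝓝 t) := by
    have h1 : Tendsto (fun n : ℕ ↦ ((⌊t / L * (2 : ℝ≥0) ^ n⌋₊ : ℕ) : ℝ≥0) / 2 ^ n) atTop
        (𝓝 (t / L)) := by
      rw [← NNReal.tendsto_coe]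
      refine ((tendsto_nat_floor_mul_div_atTop (R := ℝ) (t / L : ℝ≥0).coe_nonneg).comp
        (tendsto_pow_atTop_atTop_of_one_lt one_lt_two)).congr fun n ↦ ?_
      have h : ⌊((t / L * 2 ^ n : ℝ≥0) : ℝ)⌋₊ = ⌊t / L * 2 ^ n⌋₊ := by
        rw [Nat.floor_eq_iff (by positivity)]
        exact ⟨by exact_mod_cast Nat.floor_le (zero_le (a := t / L * 2 ^ n)),
          by exact_mod_cast Nat.lt_floor_add_one (t / L * 2 ^ n)⟩
      push_cast at h ⊢
      rw [Function.comp_apply, h]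
    have h2 := h1.const_mul L
    rw [mul_div_cancel₀ _ hL.ne'] at h2
    refine h2.congr fun n ↦ ?_
    rw [mul_div_assoc]
  refine le_of_tendsto (((hf.tendsto t).comp hlim).sub_const (f 0)).abs
    (Eventually.of_forall fun n ↦ ?_)
  refine (abs_sub_le_sum_of_dyadic h n _ ?_).trans ?_
  · refine Nat.floor_le_of_le (n := 2 ^ n) ?_
    push_cast
    exact mul_le_of_le_one_left zero_le (div_le_one_of_le₀ ht zero_le)
  · rw [← Finset.mul_sum, div_eq_mul_inv]
    gcongr
    rw [← tsum_geometric_of_lt_one hr hr1]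
    exact (summable_geometric_of_lt_one hr hr1).sum_le_tsum _ fun _ _ ↦ by positivity

/-- A continuous path whose dyadic increments on `[0, 4 ^ m]` are `o(2 ^ m)`, with a geometric
gain in the generation, is `o(√t)`. -/
lemma eventually_abs_le_mul_sqrt {b : ℝ≥0 → ℝ} (hb : Continuous b) (hb0 : b 0 = 0) {r : ℝ}
    (hr : 0 ≤ r) (hr1 : r < 1)
    (h : ∀ η > 0, ∀ᶠ m : ℕ in atTop, ∀ n : ℕ, ∀ k < 2 ^ n,
      |b (4 ^ m * (k + 1 : ℕ) / 2 ^ n) - b (4 ^ m * k / 2 ^ n)| ≤ η * 2 ^ m * r ^ n)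
    {δ : ℝ} (hδ : 0 < δ) : ∀ᶠ t : ℝ≥0 in atTop, |b t| ≤ δ * √(1 + t) := by
  have hr' : 0 < 1 - r := by linarith
  -- Chaining costs 1/(1 - r), and t ∈ [4^m, 4^(m+1)) is treated at scale m + 1, which costs a
  -- factor 2.
  obtain ⟨m₀, hm₀⟩ := eventually_atTop.1 (h (δ / 2 * (1 - r)) (by positivity))
  filter_upwards [eventually_ge_atTop (4 ^ m₀)] with t ht
  obtain ⟨m, hm, hm'⟩ := exists_nat_pow_near ((one_le_pow₀ (by norm_num)).trans ht)
    (show (1 : ℝ≥0) < 4 by norm_num)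
  have hmm : m₀ < m + 1 := (pow_lt_pow_iff_right₀ (by norm_num)).1 (ht.trans_lt hm')
  have h1 := abs_sub_le_of_dyadic hb hr hr1 (hm₀ (m + 1) hmm.le) hm'.le
  rw [hb0, sub_zero] at h1
  have h2 : (2 : ℝ) ^ m ≤ √(1 + t) := by
    refine Real.le_sqrt_of_sq_le ?_
    have : ((4 : ℝ)) ^ m ≤ t := by exact_mod_cast hm
    rw [← pow_mul, mul_comm m, pow_mul]
    norm_num
    linarith
  calc |b t| ≤ _ := h1
    _ = δ * 2 ^ m := by field_simp; ring
    _ ≤ _ := by gcongr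

/-! ### Gaussian moments and the growth of fractional Brownian motion -/

/-- The absolute moments of a centred Gaussian variable scale with its standard deviation. -/
lemma lintegral_enorm_pow_of_hasGaussianLaw {Ω : Type*} [MeasurableSpace Ω] {P : Measure Ω}
    {X : Ω → ℝ} (hX : HasGaussianLaw X P) (h0 : P[X] = 0) (p : ℕ) :
    ∫⁻ ω, ‖X ω‖ₑ ^ p ∂P =
      ENNReal.ofReal √Var[X; P] ^ p * ∫⁻ x, ‖x‖ₑ ^ p ∂(gaussianReal 0 1) := by
  have h1 : P.map X = (gaussianReal 0 1).map (√Var[X; P] * ·) := by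
    rw [hX.map_eq_gaussianReal, gaussianReal_map_const_mul, h0, mul_zero, mul_one]
    congr 1
    ext
    simp [Real.sq_sqrt, variance_nonneg]
  calc ∫⁻ ω, ‖X ω‖ₑ ^ p ∂P = ∫⁻ x, ‖x‖ₑ ^ p ∂(P.map X) :=
        (lintegral_map' (f := fun x ↦ ‖x‖ₑ ^ p) (by fun_prop) hX.aemeasurable).symm
    _ = ∫⁻ x, ‖√Var[X; P] * x‖ₑ ^ p ∂(gaussianReal 0 1) := by
        rw [h1, lintegral_map (by fun_prop) (by fun_prop)]
    _ = _ := by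
        simp_rw [enorm_mul, mul_pow]
        rw [lintegral_const_mul _ (by fun_prop), Real.enorm_of_nonneg (Real.sqrt_nonneg _)]

lemma lintegral_enorm_pow_gaussianReal_ne_top (p : ℕ) :
    ∫⁻ x, ‖x‖ₑ ^ p ∂(gaussianReal 0 1) ≠ ∞ := by
  rcases eq_or_ne p 0 with rfl | hp
  · simp
  · have h := memLp_id_gaussianReal' (μ := 0) (v := 1) (p : ℝ≥0∞) (by simp)
    have := lintegral_rpow_enorm_lt_top_of_eLpNorm_lt_top (by simpa using hp) (by simp) h.2
    simpa using this.ne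

namespace IsFractionalBrownianMotion

variable {Ω : Type*} [MeasurableSpace Ω] {P : Measure Ω} {H : ℝ} {B : ℝ≥0 → Ω → ℝ}

lemma integral_mul_self (hB : IsFractionalBrownianMotion H B P) (hH : 0 < H) (t : ℝ≥0) :
    ∫ ω, B t ω * B t ω ∂P = (t : ℝ) ^ (2 * H) := by
  rw [hB.covariance_eq t t, sub_self, abs_zero, Real.zero_rpow (by positivity)]
  ring

lemma ae_zero_eq_zero (hB : IsFractionalBrownianMotion H B P) (hH : 0 < H) :
    ∀ᵐ ω ∂P, B 0 ω = 0 := by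
  have h := hB.integral_mul_self hH 0
  rw [NNReal.coe_zero, Real.zero_rpow (by positivity), integral_eq_zero_iff_of_nonneg
    (fun ω ↦ mul_self_nonneg _)
    ((hB.isGaussianProcess.hasGaussianLaw_eval 0).memLp_two.integrable_mul
      (hB.isGaussianProcess.hasGaussianLaw_eval 0).memLp_two)] at h
  filter_upwards [h] with ω hω
  simpa using hω

lemma variance_sub (hB : IsFractionalBrownianMotion H B P) (hH : 0 < H) (s t : ℝ≥0) :
    Var[fun ω ↦ B t ω - B s ω; P] = |(t : ℝ) - s| ^ (2 * H) := by
  have hm : ∀ u, MemLp (B u) 2 P := fun u ↦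
    (hB.isGaussianProcess.hasGaussianLaw_eval u).memLp_two
  have hi : ∀ u, Integrable (B u) P := fun u ↦
    (hB.isGaussianProcess.hasGaussianLaw_eval u).integrable
  have hii : ∀ u v, Integrable (fun ω ↦ B u ω * B v ω) P := fun u v ↦
    (hm u).integrable_mul (hm v)
  have hadd : Integrable (fun ω ↦ B t ω * B t ω + B s ω * B s ω) P := (hii t t).add (hii s s)
  rw [variance_of_integral_eq_zero (hB.isGaussianProcess.hasGaussianLaw_fun_sub).aemeasurable
    (by rw [integral_sub (hi t) (hi s), hB.mean_eq_zero, hB.mean_eq_zero, sub_zero])]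
  calc ∫ ω, (B t ω - B s ω) ^ 2 ∂P
      = ∫ ω, (B t ω * B t ω + B s ω * B s ω - 2 * (B t ω * B s ω)) ∂P := by
        congr 1 with ω
        ring
    _ = |(t : ℝ) - s| ^ (2 * H) := by
        rw [integral_sub hadd ((hii t s).const_mul 2),
          integral_add (hii t t) (hii s s), integral_const_mul, hB.integral_mul_self hH,
          hB.integral_mul_self hH, hB.covariance_eq s t]
        ring

/-- The moments of the increments of a fractional Brownian motion. -/
lemma lintegral_enorm_sub_pow (hB : IsFractionalBrownianMotion H B P) (hH : 0 < H) (s t : ℝ≥0)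
    (p : ℕ) : ∫⁻ ω, ‖B t ω - B s ω‖ₑ ^ p ∂P =
      ENNReal.ofReal (|(t : ℝ) - s| ^ H) ^ p * ∫⁻ x, ‖x‖ₑ ^ p ∂(gaussianReal 0 1) := by
  have hi : ∀ u, Integrable (B u) P := fun u ↦
    (hB.isGaussianProcess.hasGaussianLaw_eval u).integrable
  rw [lintegral_enorm_pow_of_hasGaussianLaw hB.isGaussianProcess.hasGaussianLaw_fun_sub
    (by rw [integral_sub (hi t) (hi s), hB.mean_eq_zero, hB.mean_eq_zero, sub_zero]),
    hB.variance_sub hH, mul_comm 2 H, Real.rpow_mul (abs_nonneg _), Real.rpow_two,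
    Real.sqrt_sq (by positivity)]

/-- Almost every path of a fractional Brownian motion with Hurst index below `1 / 2` is
`o(√t)` as `t → ∞`. -/
lemma ae_eventually_abs_le_mul_sqrt (hB : IsFractionalBrownianMotion H B P) (hH : 0 < H)
    (hH' : H < 1 / 2) :
    ∀ᵐ ω ∂P, ∀ δ > 0, ∀ᶠ t : ℝ≥0 in atTop, |B t ω| ≤ δ * √(1 + t) := by
  -- With r = 2^(-H/2), the condition pH > 2 gives 2r^p < 1, so the moments beat the 2^n intervals
  -- of generation n.
  obtain ⟨p, hp⟩ := exists_nat_gt (2 / H)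
  rw [div_lt_iff₀ hH] at hp
  have hp0 : p ≠ 0 := by
    rintro rfl
    norm_num at hp
  set r : ℝ := 2 ^ (-(H / 2)) with hr
  have hr0 : 0 < r := by positivity
  have hr1 : r < 1 := Real.rpow_lt_one_of_one_lt_of_neg one_lt_two (by linarith)
  -- The ratio of the noise scale (4^m)^H to 2^m is q^m; q < 1 is where H < 1/2 enters.
  set q : ℝ := 2 ^ (2 * H - 1) with hq
  have hq0 : 0 < q := by positivity
  have hq1 : q < 1 := Real.rpow_lt_one_of_one_lt_of_neg one_lt_two (by linarith)
  set c := ∫⁻ x, ‖x‖ₑ ^ p ∂(gaussianReal 0 1) with hc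
  -- the normalised increments
  set D : ℕ → ℕ → ℕ → Ω → ℝ≥0∞ := fun m n k ω ↦
    (‖B (4 ^ m * (k + 1 : ℕ) / 2 ^ n) ω - B (4 ^ m * k / 2 ^ n) ω‖ₑ *
      ENNReal.ofReal (2 ^ m * r ^ n)⁻¹) ^ p with hD
  have hDm : ∀ m n k, AEMeasurable (D m n k) P := fun m n k ↦ by
    have h1 := hB.isGaussianProcess.aemeasurable
    have h2 := h1 (4 ^ m * (k + 1 : ℕ) / 2 ^ n)
    have h3 := h1 (4 ^ m * k / 2 ^ n)
    exact (((h2.sub h3).enorm).mul_const _).pow_const p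
  have hDint : ∀ m n k, ∫⁻ ω, D m n k ω ∂P =
      c * ((ENNReal.ofReal q ^ p) ^ m * (ENNReal.ofReal r ^ p) ^ n) := fun m n k ↦ by
    -- The standard deviation is 2^((2m-n)H). Only half of the decay 2^(-nH) is spent on the
    -- normalisation r^n; the other half remains for summability.
    have h1 : |((4 ^ m * (k + 1 : ℕ) / 2 ^ n : ℝ≥0) : ℝ) - (4 ^ m * k / 2 ^ n : ℝ≥0)| ^ H *
        (2 ^ m * r ^ n)⁻¹ = q ^ m * r ^ n := by
      have h2 : ((4 ^ m * (k + 1 : ℕ) / 2 ^ n : ℝ≥0) : ℝ) - (4 ^ m * k / 2 ^ n : ℝ≥0) =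
          2 ^ (2 * m - n : ℝ) := by
        rw [Real.rpow_sub two_pos, Real.rpow_natCast, Real.rpow_mul two_pos.le, Real.rpow_natCast]
        push_cast
        norm_num
        ring
      rw [h2, abs_of_pos (by positivity), hr, hq, ← Real.rpow_natCast, ← Real.rpow_natCast,
        ← Real.rpow_natCast, ← Real.rpow_mul two_pos.le, ← Real.rpow_mul two_pos.le,
        ← Real.rpow_mul two_pos.le, ← Real.rpow_add two_pos, ← Real.rpow_neg two_pos.le,
        ← Real.rpow_add two_pos, ← Real.rpow_add two_pos]
      congr 1
      ring
    simp_rw [hD, mul_pow]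
    rw [lintegral_mul_const' _ _ (by finiteness), hB.lintegral_enorm_sub_pow hH,
      mul_right_comm, ← mul_pow, ← ENNReal.ofReal_mul (by positivity), h1,
      ENNReal.ofReal_mul (by positivity), ENNReal.ofReal_pow hq0.le, ENNReal.ofReal_pow hr0.le,
      mul_comm c, mul_pow, ← pow_mul, ← pow_mul, ← pow_mul, ← pow_mul, mul_comm m, mul_comm n]
  have hfin : ∫⁻ ω, ∑' m, ∑' n, ∑ k ∈ Finset.range (2 ^ n), D m n k ω ∂P ≠ ∞ := by
    have hsum : ∀ m n, AEMeasurable (fun ω ↦ ∑ k ∈ Finset.range (2 ^ n), D m n k ω) P :=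
      fun m n ↦ Finset.aemeasurable_fun_sum _ fun k _ ↦ hDm m n k
    rw [lintegral_tsum fun m ↦ AEMeasurable.tsum (hsum m)]
    simp_rw [lintegral_tsum (hsum _), lintegral_finsetSum' _ fun k _ ↦ hDm _ _ k, hDint,
      Finset.sum_const, Finset.card_range, nsmul_eq_mul]
    have h1 : ∀ m n : ℕ, ((2 ^ n : ℕ) : ℝ≥0∞) *
        (c * ((ENNReal.ofReal q ^ p) ^ m * (ENNReal.ofReal r ^ p) ^ n)) =
        c * ((ENNReal.ofReal q ^ p) ^ m * (2 * ENNReal.ofReal r ^ p) ^ n) := fun m n ↦ by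
      rw [mul_pow]
      push_cast
      ring
    simp_rw [h1, ENNReal.tsum_mul_left, ENNReal.tsum_mul_right, ENNReal.tsum_geometric]
    have h2 : ENNReal.ofReal q ^ p < 1 :=
      pow_lt_one₀ zero_le (by simpa using hq1) hp0
    have h3 : 2 * ENNReal.ofReal r ^ p < 1 := by
      rw [← ENNReal.ofReal_pow hr0.le, ← ENNReal.ofReal_ofNat, ← ENNReal.ofReal_mul two_pos.le,
        ENNReal.ofReal_lt_one, hr, ← Real.rpow_natCast, ← Real.rpow_mul two_pos.le]
      nth_rewrite 1 [← Real.rpow_one 2]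
      rw [← Real.rpow_add two_pos]
      exact Real.rpow_lt_one_of_one_lt_of_neg one_lt_two (by linarith)
    refine ENNReal.mul_ne_top (lintegral_enorm_pow_gaussianReal_ne_top p)
      (ENNReal.mul_ne_top ?_ ?_)
    · simpa [tsub_eq_zero_iff_le] using h2
    · simpa [tsub_eq_zero_iff_le] using h3
  have hSm : AEMeasurable (fun ω ↦ ∑' m, ∑' n, ∑ k ∈ Finset.range (2 ^ n), D m n k ω) P :=
    AEMeasurable.tsum fun m ↦ AEMeasurable.tsum fun n ↦
      Finset.aemeasurable_fun_sum _ fun k _ ↦ hDm m n k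
  filter_upwards [ae_lt_top' hSm hfin, hB.continuous_paths, hB.ae_zero_eq_zero hH]
    with ω hω hcont hzero δ hδ
  refine eventually_abs_le_mul_sqrt hcont hzero hr0.le hr1 (fun η hη ↦ ?_) hδ
  -- A finite sum over m has terms tending to zero, which controls all n and k at once for large m.
  have hlim := ENNReal.tendsto_atTop_zero_of_tsum_ne_top hω.ne
  have hη' : 0 < ENNReal.ofReal η ^ p := by positivity
  filter_upwards [hlim.eventually_le_const hη'] with m hm n k hk
  have h1 : D m n k ω ≤ ENNReal.ofReal η ^ p := by
    refine le_trans ?_ hm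
    refine le_trans ?_ (ENNReal.le_tsum n)
    exact Finset.single_le_sum_of_canonicallyOrdered (f := fun k ↦ D m n k ω)
      (Finset.mem_range.2 hk)
  have h2 := (ENNReal.pow_le_pow_left_iff hp0).1 h1
  rw [← ofReal_norm, ← ENNReal.ofReal_mul (norm_nonneg _), ENNReal.ofReal_le_ofReal_iff hη.le,
    ← div_eq_mul_inv, div_le_iff₀ (by positivity), Real.norm_eq_abs] at h2
  linarith

end IsFractionalBrownianMotion

/-! ### A common modulus with high probability -/

/-- For a continuous path, it suffices to check the modulus on a dense set of times. -/
lemma hasDiffusiveModulus_of_dense {η C : ℝ} {b : ℝ≥0 → ℝ} (hb : Continuous b) {D : Set ℝ≥0}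
    (hD : Dense D) (h : ∀ s ∈ D, ∀ t ∈ D, |b t - b s| ≤ η * √(1 + ((max s t : ℝ≥0) : ℝ)) +
      C * |(t : ℝ) - s| / √(1 + ((max s t : ℝ≥0) : ℝ))) : HasDiffusiveModulus η C b := by
  have hc : IsClosed {x : ℝ≥0 × ℝ≥0 | |b x.2 - b x.1| ≤ η * √(1 + ((max x.1 x.2 : ℝ≥0) : ℝ)) +
      C * |(x.2 : ℝ) - x.1| / √(1 + ((max x.1 x.2 : ℝ≥0) : ℝ))} := by
    refine isClosed_le (by fun_prop) (.add (by fun_prop) (.div (by fun_prop) (by fun_prop)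
      fun x ↦ ?_))
    positivity
  intro s t
  exact closure_minimal (s := D ×ˢ D) (fun x hx ↦ h x.1 hx.1 x.2 hx.2) hc ((hD.prod hD) (s, t))

/-- With probability close to one, the paths of a fractional Brownian motion with Hurst index below
`1 / 2` have a common modulus on the diffusive scale. -/
lemma IsFractionalBrownianMotion.exists_measure_not_hasDiffusiveModulus_lt {Ω : Type*}
    [MeasurableSpace Ω] {P : Measure Ω} {H : ℝ} {B : ℝ≥0 → Ω → ℝ}
    (hB : IsFractionalBrownianMotion H B P) (hH : 0 < H) (hH' : H < 1 / 2) {η : ℝ} (hη : 0 < η)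
    {ε : ℝ≥0∞} (hε : 0 < ε) :
    ∃ n : ℕ, P {ω | ¬HasDiffusiveModulus η n fun t ↦ B t ω} < ε := by
  have := hB.isGaussianProcess.isProbabilityMeasure
  set A : ℕ → Set Ω := fun n ↦ {ω | ¬HasDiffusiveModulus η n fun t ↦ B t ω}
  -- Up to a null set, path continuity reduces the uncountably many conditions to countably many;
  -- continuity from above then applies to the decreasing sets `A n`.
  have hA : ∀ n, NullMeasurableSet (A n) P := fun n ↦ by
    have h1 : NullMeasurableSet {ω | ∀ s ∈ range (TopologicalSpace.denseSeq ℝ≥0),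
        ∀ t ∈ range (TopologicalSpace.denseSeq ℝ≥0),
        |B t ω - B s ω| ≤ η * √(1 + ((max s t : ℝ≥0) : ℝ)) +
          n * |(t : ℝ) - s| / √(1 + ((max s t : ℝ≥0) : ℝ))} P := by
      simp only [ofPred_forall]
      refine .biInter (countable_range _) fun s _ ↦ .biInter (countable_range _) fun t _ ↦ ?_
      exact nullMeasurableSet_le (((hB.isGaussianProcess.aemeasurable t).sub
        (hB.isGaussianProcess.aemeasurable s)).abs) aemeasurable_const
    refine h1.compl.congr ?_
    filter_upwards [hB.continuous_paths] with ω hω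
    refine propext (not_congr ⟨fun h ↦ ?_, fun h s _ t _ ↦ h s t⟩)
    exact hasDiffusiveModulus_of_dense hω (TopologicalSpace.denseRange_denseSeq ℝ≥0) h
  have hanti : Antitone A := fun m n hmn ω h h' ↦ h (h'.mono (by exact_mod_cast hmn))
  have hlim := tendsto_measure_iInter_atTop hA hanti ⟨0, measure_ne_top P _⟩
  have h0 : P (⋂ n, A n) = 0 := by
    refine measure_mono_null (t := {ω | ¬∃ n : ℕ, HasDiffusiveModulus η n fun t ↦ B t ω})
      (fun ω hω ↦ ?_) ?_
    · rintro ⟨n, hn⟩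
      exact mem_iInter.1 hω n hn
    · rw [← ae_iff]
      filter_upwards [hB.continuous_paths, hB.ae_eventually_abs_le_mul_sqrt hH hH'] with ω h1 h2
      exact exists_hasDiffusiveModulus hη h1 h2
  rw [h0] at hlim
  exact (hlim.eventually_lt_const hε).exists

end FracBessel

/-! ### The hitting probability -/

theorem mainTheorem4 {Ω : Type*} [MeasurableSpace Ω] (P : Measure Ω) [IsProbabilityMeasure P]
    (H : ℝ) (hH : 0 < H) (hH' : H < 1 / 2) (x₀ σ : ℝ) (hx₀ : 0 < x₀) (hσ : 0 < σ)
    (B : ℝ≥0 → Ω → ℝ) (hB : FracBessel.IsFractionalBrownianMotion H B P) :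
    ∀ ε : ℝ, 0 < ε → ∃ a₀ : ℝ, 0 < a₀ ∧ ∀ a : ℝ, a₀ ≤ a →
      P {ω | (⨅ t : ℝ≥0, FracBessel.besselProcess x₀ a σ B t ω) = 0} < ENNReal.ofReal ε ∧
      P {ω | ∃ t : ℝ≥0, FracBessel.besselProcess x₀ a σ B t ω = 0} < ENNReal.ofReal ε := by
  intro ε hε
  obtain ⟨ρ, hρ⟩ : ∃ ρ, ρ = x₀ / 2 := ⟨_, rfl⟩
  have hρ0 : 0 < ρ := by linarith
  -- The barrier argument allows ση ≤ ρ/2, attained here with equality.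
  obtain ⟨n, hn⟩ := hB.exists_measure_not_hasDiffusiveModulus_lt hH hH'
    (η := ρ / 2 / σ) (by positivity) (ENNReal.ofReal_pos.2 hε)
  refine ⟨3 * ρ * (σ * n + 2 * ρ), by positivity, fun a ha ↦ ?_⟩
  have key : ∀ᵐ ω ∂P, FracBessel.HasDiffusiveModulus (ρ / 2 / σ) n (fun t ↦ B t ω) →
      ∀ t, ρ ≤ FracBessel.besselProcess x₀ a σ B t ω := by
    filter_upwards [hB.continuous_paths, hB.ae_zero_eq_zero hH] with ω h1 h2 h3
    exact FracBessel.le_besselPath hρ0 hσ h1 h3 h2 (by linarith)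
      (mul_div_cancel₀ _ hσ.ne').le (Nat.cast_nonneg n) ha
  constructor
  -- Almost-everywhere inclusion in the exceptional event suffices, so measurability of the hitting
  -- events plays no role.
  · refine lt_of_le_of_lt (measure_mono_ae ?_) hn
    filter_upwards [key] with ω hω h0 hmod
    have h0' : (⨅ t : ℝ≥0, FracBessel.besselProcess x₀ a σ B t ω) = 0 := h0
    have := le_ciInf (hω hmod)
    linarith
  · refine lt_of_le_of_lt (measure_mono_ae ?_) hn
    filter_upwards [key] with ω hω h0 hmod
    obtain ⟨t, ht⟩ := h0
    have := hω hmod t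
    linarith
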